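/- Let $0<q<1$ be real. For complex $a$ write $(a;q)_n=\prod_{k=0}^{n-1}(1-aq^k)$, $(a;q)_\infty=\prod_{k=0}^{\infty}(1-aq^k)$ and $(a_1,\dots,a_m;q)_n=(a_1;q)_n\cdots(a_m;q)_n$ for $n\in\{0,1,2,\dots\}\cup\{\infty\}$. Let $a,b\in\mathbb{C}$ satisfy $|ab/q|<1$ and $aq^{k}\neq 1$, $bq^{k}\neq 1$ for all integers $k\ge 1$. Then \[ \frac{(q,ab;q)_\infty}{(qa,qb;q)_\infty}\sum_{n=0}^\infty\frac{(q/a,q/b;q)_n(ab/q)^n}{(q^2;q^2)_n} =\sum_{n=0}^\infty\sum_{j=-n}^n(-1)^j(1-q^{2n+1})q^{j^2}\frac{(q/a,q/b;q)_n(ab/q)^n}{(qa,qb;q)_n}, \] where both series over $n$ converge absolutely. If $a=0$ or $b=0$, the product $(q/a,q/b;q)_n(ab/q)^n$ is understood as its continuous extension $q^{-n}\prod_{k=1}^{n}(a-q^k)(b-q^k)$. In particular, taking $(a,b)=(0,0)$, $(1,0)$ and $(-1,0)$ respectively, \[ \sum_{n=0}^\infty\frac{q^{n^2}}{(q^2;q^2)_n}=\frac{1}{(q;q)_\infty}\sum_{n=0}^\infty\sum_{j=-n}^n(-1)^j(1-q^{2n+1})q^{n^2+j^2},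 \] \[ \sum_{n=0}^\infty\frac{(-1)^nq^{n(n-1)/2}}{(-q;q)_n}=\sum_{n=0}^\infty\sum_{j=-n}^n(-1)^{n+j}(1-q^{2n+1})q^{j^2+n(n-1)/2}, \] \[ \sum_{n=0}^\infty\frac{q^{n(n-1)/2}}{(q;q)_n}=\frac{(-q;q)_\infty}{(q;q)_\infty}\sum_{n=0}^\infty\sum_{j=-n}^n(-1)^j(1-q^{2n+1})q^{j^2+n(n-1)/2}, \] again with all series over $n$ absolutely convergent. -/

import Mathlib

/-- The finite `q`-shifted factorial `(a; q)_n = ∏_{k=0}^{n-1} (1 - a q^k)`. -/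
def qPoch (a q : ℂ) (n : ℕ) : ℂ :=
  ∏ k ∈ Finset.range n, (1 - a * q ^ k)

/-- The infinite `q`-shifted factorial `(a; q)_∞ = ∏_{k=0}^∞ (1 - a q^k)`. -/
noncomputable def qPochInf (a q : ℂ) : ℂ :=
  ∏' k : ℕ, (1 - a * q ^ k)

/-- The polynomial `∏_{k=0}^{n-1} (a - q^{k+1})` in `a`, which is `(q/a; q)_n a^n` for `a ≠ 0`
and whose value at `a = 0` is the limit of `(q/a; q)_n a^n` as `a → 0`. -/
def qPochMulPow (a q : ℂ) (n : ℕ) : ℂ :=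
  ∏ k ∈ Finset.range n, (a - q ^ (k + 1))

/-- The infinite product defining `(a; q)_∞` converges for `|q| < 1`. -/
theorem hasProd_qPochInf (a q : ℂ) (hq : ‖q‖ < 1) :
    HasProd (fun k : ℕ => 1 - a * q ^ k) (qPochInf a q) := by
  have h : Multipliable (fun k : ℕ => 1 + (-(a * q ^ k))) := by
    apply multipliable_one_add_of_summable
    have hs : Summable (fun k : ℕ => ‖a‖ * ‖q‖ ^ k) :=
      (summable_geometric_of_lt_one (norm_nonneg q) hq).mul_left _
    simpa using hs
  simpa [qPochInf, sub_eq_add_neg] using h.hasProd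

theorem qPochMulPow_eq (a q : ℂ) (ha : a ≠ 0) (n : ℕ) :
    qPochMulPow a q n = qPoch (q / a) q n * a ^ n := by
  induction n with
  | zero => simp [qPochMulPow, qPoch]
  | succ n ih =>
    unfold qPochMulPow qPoch at *
    rw [Finset.prod_range_succ, Finset.prod_range_succ, ih]
    have h : a - q ^ (n + 1) = (1 - q / a * q ^ n) * a := by
      field_simp
      ring
    rw [h]
    ring

/-! This is Bailey's lemma applied to one Bailey pair relative to `q`. Put P_n = ∏_{k=1}^n (a -
q^k)(b - q^k), a polynomial in a and b, so that zero parameters need no separate argument, and α_r =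
(1 - q^{2r+1}) q^{-r} ∑_{|j|≤r} (-1)^j q^{j²}. The double series ∑_{r,m} α_r P_{r+m} / ((q;q)_m
(q;q)_{2r+m+1}) converges absolutely because |ab| < |q|, and it is summed in two ways.

For fixed r the sum over m is a q-Gauss series, whose closed form (`tsum_gaussTerm`) produces the
infinite products and the r-th term of the theta side. For fixed n = r + m the sum is finite, and
`sum_bailey_pair` evaluates it as P_n q^{-n} / (q²;q²)_n. Comparing the two gives `hasSum_bailey`;
the rest is specialisation. -/

/-! ### Finite and infinite q-shifted factorials -/

theorem qPoch_succ (a q : ℂ) (n : ℕ) : qPoch a q (n + 1) = qPoch a q n * (1 - a * q ^ n) := by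
  simp [qPoch, Finset.prod_range_succ]

theorem qPochMulPow_succ (a q : ℂ) (n : ℕ) :
    qPochMulPow a q (n + 1) = qPochMulPow a q n * (a - q ^ (n + 1)) := by
  simp [qPochMulPow, Finset.prod_range_succ]

theorem qPoch_add (a q : ℂ) (m n : ℕ) :
    qPoch a q (m + n) = qPoch a q m * qPoch (a * q ^ m) q n := by
  simp only [qPoch, Finset.prod_range_add, pow_add, mul_assoc]

theorem qPoch_ne_zero {a q : ℂ} (h : ∀ k : ℕ, a * q ^ k ≠ 1) (n : ℕ) : qPoch a q n ≠ 0 :=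
  Finset.prod_ne_zero_iff.2 fun k _ => sub_ne_zero.2 (h k).symm

theorem mul_pow_ne_one {a q : ℂ} (ha : ‖a‖ < 1) (hq : ‖q‖ < 1) (k : ℕ) : a * q ^ k ≠ 1 := by
  intro h
  have h1 : ‖a * q ^ k‖ < 1 := by
    rw [norm_mul, norm_pow]
    exact mul_lt_one_of_nonneg_of_lt_one_left (norm_nonneg _) ha
      (pow_le_one₀ (norm_nonneg _) hq.le)
  simp [h] at h1

theorem qPoch_self_ne_zero {q : ℂ} (hq : ‖q‖ < 1) (n : ℕ) : qPoch q q n ≠ 0 :=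
  qPoch_ne_zero (mul_pow_ne_one hq hq) n

theorem qPoch_sq (q : ℂ) (n : ℕ) :
    qPoch (q ^ 2) (q ^ 2) n = qPoch q q n * qPoch (-q) q n := by
  simp only [qPoch, ← Finset.prod_mul_distrib]
  refine Finset.prod_congr rfl fun k _ => ?_
  ring

theorem qPoch_sq_ne_zero {q : ℂ} (hq : ‖q‖ < 1) (n : ℕ) : qPoch (q ^ 2) (q ^ 2) n ≠ 0 := by
  refine qPoch_self_ne_zero ?_ n
  rw [norm_pow]
  exact pow_lt_one₀ (norm_nonneg _) hq two_ne_zero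

theorem summable_norm_neg_mul_pow (a : ℂ) {q : ℂ} (hq : ‖q‖ < 1) :
    Summable fun k : ℕ => ‖-(a * q ^ k)‖ := by
  simpa using (summable_geometric_of_lt_one (norm_nonneg q) hq).mul_left ‖a‖

theorem qPochInf_ne_zero {a q : ℂ} (hq : ‖q‖ < 1) (h : ∀ k : ℕ, a * q ^ k ≠ 1) :
    qPochInf a q ≠ 0 := by
  have := tprod_one_add_ne_zero_of_summable (f := fun k : ℕ => -(a * q ^ k))
    (fun k => by simpa [← sub_eq_add_neg] using sub_ne_zero.2 (h k).symm)
    (summable_norm_neg_mul_pow a hq)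
  simpa [qPochInf, sub_eq_add_neg] using this

theorem tendsto_qPoch (a : ℂ) {q : ℂ} (hq : ‖q‖ < 1) :
    Filter.Tendsto (qPoch a q) Filter.atTop (nhds (qPochInf a q)) :=
  (hasProd_qPochInf a q hq).tendsto_prod_nat

theorem qPochInf_eq_mul (a : ℂ) {q : ℂ} (hq : ‖q‖ < 1) (n : ℕ) :
    qPochInf a q = qPoch a q n * qPochInf (a * q ^ n) q := by
  refine tendsto_nhds_unique ((Filter.tendsto_add_atTop_iff_nat n).2 (tendsto_qPoch a hq)) ?_
  simp_rw [add_comm _ n, qPoch_add]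
  exact (tendsto_qPoch _ hq).const_mul _

/-! ### The Bailey pair relative to q -/

/-- `1 / (q; q)_k` for an integer `k`, with value `0` for negative `k`. -/
noncomputable def qPochRecip (q : ℂ) (k : ℤ) : ℂ :=
  if k < 0 then 0 else (qPoch q q k.toNat)⁻¹

theorem qPochRecip_natCast (q : ℂ) (n : ℕ) : qPochRecip q n = (qPoch q q n)⁻¹ := by
  simp [qPochRecip]

theorem qPochRecip_of_neg (q : ℂ) {k : ℤ} (hk : k < 0) : qPochRecip q k = 0 := by
  simp [qPochRecip, hk]

/-- The value 0 at negative indices makes this recurrence valid for every integer: at k = 0 the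
factor 1 - q^0 vanishes. Telescoping sums therefore need no boundary cases. -/
theorem qPochRecip_sub_one {q : ℂ} (hq : ‖q‖ < 1) (k : ℤ) :
    qPochRecip q (k - 1) = qPochRecip q k * (1 - q ^ k) := by
  rcases lt_trichotomy k 0 with hk | rfl | hk
  · rw [qPochRecip_of_neg q hk, qPochRecip_of_neg q (by lia), zero_mul]
  · rw [qPochRecip_of_neg q (by lia)]
    simp
  · obtain ⟨n, rfl⟩ : ∃ n : ℕ, k = (n + 1 : ℕ) := ⟨(k - 1).toNat, by lia⟩
    have h : ((n + 1 : ℕ) : ℤ) - 1 = n := by simp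
    have h1 := qPoch_self_ne_zero hq (n + 1)
    rw [h, qPochRecip_natCast, qPochRecip_natCast, zpow_natCast]
    rw [qPoch_succ] at h1 ⊢
    have h2 := left_ne_zero_of_mul h1
    have h3 := right_ne_zero_of_mul h1
    rw [← pow_succ'] at h3 ⊢
    field_simp

/-- The coefficients of `∑_{j ∈ ℤ} (-1)^j q^{j²}` folded to `j ≥ 0`. -/
def thetaCoeff (q : ℂ) (j : ℕ) : ℂ :=
  if j = 0 then 1 else 2 * (-1) ^ j * q ^ (j ^ 2)

theorem sum_Icc_theta (q : ℂ) (n : ℕ) :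
    ∑ j ∈ Finset.Icc (-(n : ℤ)) n, (-1 : ℂ) ^ j * q ^ (j ^ 2) =
      ∑ j ∈ Finset.range (n + 1), thetaCoeff q j := by
  have h0 (j : ℕ) : (-1 : ℂ) ^ (j : ℤ) * q ^ ((j : ℤ) ^ 2) = (-1) ^ j * q ^ (j ^ 2) := by
    rw [zpow_natCast]
    norm_cast
  rw [Finset.sum_Icc_of_even_eq_range, Finset.sum_range_succ', Finset.sum_range_succ']
  · simp only [h0]
    simp [thetaCoeff, Finset.mul_sum, mul_assoc]
    ring
  · intro j
    simp [zpow_neg, ← inv_zpow]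

/-- Writing S_n for the sum in `sum_thetaCoeff_mul_qPochRecip`, this is (1 - q^{2n}) S_n - S_{n-1}
truncated at J, in a closed form that allows induction on J. At J = n the right side contains
1/(q;q)_{-1} = 0, which leaves the recurrence for S_n. -/
theorem sum_thetaCoeff_sub {q : ℂ} (hq : ‖q‖ < 1) (hq0 : q ≠ 0) (n : ℤ) (J : ℕ) :
    ∑ j ∈ Finset.range (J + 1), thetaCoeff q j *
        ((1 - q ^ (2 * n)) * (qPochRecip q (n - j) * qPochRecip q (n + j)) -
          qPochRecip q (n - 1 - j) * qPochRecip q (n - 1 + j)) =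
      2 * (-1) ^ J * q ^ (J ^ 2 + J) * q ^ n *
        (qPochRecip q (n - J - 1) * qPochRecip q (n + J)) := by
  induction J with
  | zero =>
    have h := qPochRecip_sub_one hq n
    simp [thetaCoeff, h, two_mul, zpow_add₀ hq0]
    ring
  | succ J ih =>
    have h1 := qPochRecip_sub_one hq (n - J - 1)
    have h2 := qPochRecip_sub_one hq (n + J + 1)
    rw [show n + J + 1 - 1 = n + J by ring] at h2
    rw [Finset.sum_range_succ, ih]
    push_cast
    rw [show n - 1 - ((J : ℤ) + 1) = n - J - 1 - 1 by ring,
      show n - ((J : ℤ) + 1) = n - J - 1 by ring,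
      show n - 1 + ((J : ℤ) + 1) = n + J by ring, ← add_assoc n, h1, h2]
    have e0 : q ^ n = q ^ (n - J - 1) * q ^ J * q := by
      rw [← zpow_natCast q J, ← zpow_add₀ hq0, ← zpow_add_one₀ hq0]
      congr 1
      ring
    have e1 : q ^ (n + J + 1) = q ^ (n - J - 1) * q ^ J * q * q ^ J * q := by
      rw [← e0, zpow_add_one₀ hq0, zpow_add₀ hq0, zpow_natCast]
    have e2 : q ^ (2 * n) = q ^ n * q ^ n := by rw [two_mul, zpow_add₀ hq0]
    rw [e2, e1, e0]
    simp only [thetaCoeff, Nat.succ_ne_zero, if_false]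
    ring

theorem sum_thetaCoeff_mul_qPochRecip {q : ℂ} (hq : ‖q‖ < 1) (hq0 : q ≠ 0) (n : ℕ) :
    ∑ j ∈ Finset.range (n + 1), thetaCoeff q j *
        (qPochRecip q ((n : ℤ) - j) * qPochRecip q ((n : ℤ) + j)) =
      (qPoch (q ^ 2) (q ^ 2) n)⁻¹ := by
  induction n with
  | zero => simp [thetaCoeff, qPochRecip, qPoch]
  | succ n ih =>
    have h := sum_thetaCoeff_sub hq hq0 ((n : ℤ) + 1) (n + 1)
    simp only [mul_sub, Finset.sum_sub_distrib] at h
    rw [qPochRecip_of_neg q (k := (n : ℤ) + 1 - (n + 1 : ℕ) - 1) (by push_cast; lia), zero_mul,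
      mul_zero, sub_eq_zero, add_sub_cancel_right,
      Finset.sum_range_succ
        (fun j : ℕ => thetaCoeff q j * (qPochRecip q ((n : ℤ) - j) * qPochRecip q ((n : ℤ) + j))),
      qPochRecip_of_neg q (k := (n : ℤ) - (n + 1 : ℕ))
      (by push_cast; lia), zero_mul, mul_zero, add_zero, ih] at h
    have hz := qPoch_sq_ne_zero hq (n + 1)
    rw [qPoch_succ] at hz ⊢
    have h2 := left_ne_zero_of_mul hz
    have h3 := right_ne_zero_of_mul hz
    have e : q ^ (2 * ((n : ℤ) + 1)) = q ^ 2 * (q ^ 2) ^ n := by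
      rw [← pow_mul, ← pow_add, ← zpow_natCast]
      congr 1
      push_cast
      ring
    simp only [e] at h
    rw [mul_inv, ← div_eq_mul_inv, eq_div_iff h3, ← h, Finset.sum_mul]
    refine Finset.sum_congr rfl fun x _ => ?_
    push_cast
    ring

/-- The Bailey pair relative to `q` whose `β` is `q^{-n} / (q²; q²)_n`. -/
theorem sum_bailey_pair {q : ℂ} (hq : ‖q‖ < 1) (hq0 : q ≠ 0) (n : ℕ) :
    ∑ r ∈ Finset.range (n + 1), (1 - q ^ (2 * r + 1)) / q ^ r *
        (∑ j ∈ Finset.range (r + 1), thetaCoeff q j) *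
        (qPochRecip q ((n : ℤ) - r) * qPochRecip q ((n : ℤ) + r + 1)) =
      (qPoch (q ^ 2) (q ^ 2) n)⁻¹ / q ^ n := by
  -- Summation by parts: with R(k) = 1/(q;q)_k, q^{n-r}(1 - q^{2r+1}) R(n-r) R(n+r+1) equals g(r) -
  -- g(r+1) for g(r) = R(n-r) R(n+r). The boundary term vanishes at N = n + 1.
  have key (N : ℕ) : q ^ n * ∑ r ∈ Finset.range N, (1 - q ^ (2 * r + 1)) / q ^ r *
        (∑ j ∈ Finset.range (r + 1), thetaCoeff q j) *
        (qPochRecip q ((n : ℤ) - r) * qPochRecip q ((n : ℤ) + r + 1)) =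
      ∑ j ∈ Finset.range N, thetaCoeff q j *
        (qPochRecip q ((n : ℤ) - j) * qPochRecip q ((n : ℤ) + j)) -
      qPochRecip q ((n : ℤ) - N) * qPochRecip q ((n : ℤ) + N) *
        ∑ j ∈ Finset.range N, thetaCoeff q j := by
    induction N with
    | zero => simp
    | succ N ih =>
      rw [Finset.sum_range_succ, mul_add, ih, Finset.sum_range_succ _ N, Finset.sum_range_succ _ N]
      have h1 := qPochRecip_sub_one hq ((n : ℤ) - N)
      have h2 := qPochRecip_sub_one hq ((n : ℤ) + N + 1)
      rw [add_sub_cancel_right] at h2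
      push_cast
      rw [← sub_sub, ← add_assoc, h1, h2]
      have e0 : q ^ n = q ^ ((n : ℤ) - N) * q ^ N := by
        rw [← zpow_natCast q N, ← zpow_add₀ hq0, sub_add_cancel, zpow_natCast]
      have e1 : q ^ ((n : ℤ) + N + 1) = q ^ ((n : ℤ) - N) * q ^ N * q ^ N * q := by
        rw [← e0, zpow_add_one₀ hq0, zpow_add₀ hq0, zpow_natCast, zpow_natCast]
      rw [e1, e0]
      have := pow_ne_zero N hq0
      field_simp
      ring
  have h := key (n + 1)
  rw [qPochRecip_of_neg q (k := (n : ℤ) - (n + 1 : ℕ)) (by push_cast; lia), zero_mul, zero_mul,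
    sub_zero, sum_thetaCoeff_mul_qPochRecip hq hq0] at h
  rw [eq_div_iff (pow_ne_zero n hq0), mul_comm, h]

/-! ### The q-Gauss summation -/

open Filter Topology in
-- Ratio test with the ratio supplied as a multiplier, so that terms may vanish, as they do when a
-- numerator terminates.
theorem summable_of_succ_eq_mul_of_tendsto {𝕜 : Type*} [NormedField 𝕜] [CompleteSpace 𝕜]
    {f g : ℕ → 𝕜} {l : 𝕜} (hfg : ∀ n, f (n + 1) = f n * g n) (hg : Tendsto g atTop (𝓝 l))
    (hl : ‖l‖ < 1) : Summable f := by
  obtain ⟨r, hlr, hr⟩ := exists_between hl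
  refine summable_of_ratio_norm_eventually_le hr ?_
  filter_upwards [hg.norm.eventually_lt_const hlr] with n hn
  rw [hfg, norm_mul, mul_comm]
  gcongr

theorem tendsto_mul_pow_zero (a : ℂ) {q : ℂ} (hq : ‖q‖ < 1) :
    Filter.Tendsto (fun n : ℕ => a * q ^ n) Filter.atTop (nhds 0) := by
  simpa using (tendsto_pow_atTop_nhds_zero_of_norm_lt_one hq).const_mul a

/-- The numerators `∏_{k<n} (a - u q^k) (b - v q^k)` of the `q`-Gauss series. -/
def gaussNum (a b u v q : ℂ) (n : ℕ) : ℂ :=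
  ∏ k ∈ Finset.range n, ((a - u * q ^ k) * (b - v * q ^ k))

/-- The terms of the `q`-Gauss series
`∑ (u/a, v/b; q)_n (ab)^n / (q, uv; q)_n`, written polynomially in `a` and `b`. -/
noncomputable def gaussTerm (a b u v q : ℂ) (n : ℕ) : ℂ :=
  gaussNum a b u v q n / (qPoch q q n * qPoch (u * v) q n)

theorem gaussNum_succ (a b u v q : ℂ) (n : ℕ) :
    gaussNum a b u v q (n + 1) =
      gaussNum a b u v q n * ((a - u * q ^ n) * (b - v * q ^ n)) := by
  simp [gaussNum, Finset.prod_range_succ]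

theorem gaussNum_scale (a b u v q c : ℂ) (n : ℕ) :
    gaussNum (a * c) b (u * c) v q n = c ^ n * gaussNum a b u v q n := by
  induction n with
  | zero => simp [gaussNum]
  | succ n ih => rw [gaussNum_succ, gaussNum_succ, ih]; ring

/-- A majorant of the `q`-Gauss series, uniform under `(a, u) ↦ (a q^N, u q^N)`. -/
noncomputable def gaussBound (a b u v q : ℂ) (n : ℕ) : ℝ :=
  ‖gaussNum a b u v q n‖ /
    (‖qPoch q q n‖ * ∏ k ∈ Finset.range n, (1 - ‖u * v‖ * ‖q‖ ^ k))

open Filter Topology in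
theorem summable_gaussBound {a b u v q : ℂ} (hq : ‖q‖ < 1) (hab : ‖a * b‖ < 1) :
    Summable (gaussBound a b u v q) := by
  refine summable_of_succ_eq_mul_of_tendsto (l := ‖a * b‖) (g := fun n =>
    ‖(a - u * q ^ n) * (b - v * q ^ n)‖ / (‖1 - q * q ^ n‖ * (1 - ‖u * v‖ * ‖q‖ ^ n))) ?_ ?_ ?_
  · intro n
    simp only [gaussBound, gaussNum_succ, qPoch_succ, norm_mul, Finset.prod_range_succ]
    rw [div_mul_div_comm]
    congr 1
    ring
  · have h1 := ((tendsto_mul_pow_zero u hq).const_sub a).mul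
      ((tendsto_mul_pow_zero v hq).const_sub b)
    have h2 := ((tendsto_mul_pow_zero q hq).const_sub 1).norm
    have h3 := ((tendsto_pow_atTop_nhds_zero_of_lt_one (norm_nonneg q) hq).const_mul
      ‖u * v‖).const_sub 1
    simpa [Pi.div_def] using h1.norm.div (h2.mul h3) (by simp)
  · simpa using hab

theorem norm_gaussTerm_le {a b u v q c : ℂ} (hq : ‖q‖ < 1) (huv : ‖u * v‖ < 1) (hc : ‖c‖ ≤ 1)
    (n : ℕ) : ‖gaussTerm (a * c) b (u * c) v q n‖ ≤ gaussBound a b u v q n := by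
  have hpos : 0 < ∏ k ∈ Finset.range n, (1 - ‖u * v‖ * ‖q‖ ^ k) := by
    refine Finset.prod_pos fun k _ => sub_pos.2 ?_
    exact mul_lt_one_of_nonneg_of_lt_one_left (norm_nonneg _) huv
      (pow_le_one₀ (norm_nonneg _) hq.le)
  have hle : ∏ k ∈ Finset.range n, (1 - ‖u * v‖ * ‖q‖ ^ k) ≤ ‖qPoch (u * c * v) q n‖ := by
    rw [qPoch, norm_prod]
    refine Finset.prod_le_prod (fun k _ => sub_nonneg.2 ?_) fun k _ => ?_
    · exact mul_le_one₀ huv.le (by positivity) (pow_le_one₀ (norm_nonneg _) hq.le)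
    · have h1 := norm_sub_norm_le 1 (u * c * v * q ^ k)
      have h2 : ‖u * c * v * q ^ k‖ ≤ ‖u * v‖ * ‖q‖ ^ k := by
        rw [mul_right_comm u, norm_mul, norm_mul _ c, norm_pow]
        gcongr
        exact mul_le_of_le_one_right (norm_nonneg _) hc
      rw [norm_one] at h1
      linarith
  have hqn : 0 < ‖qPoch q q n‖ := norm_pos_iff.2 (qPoch_self_ne_zero hq n)
  rw [gaussTerm, gaussBound, norm_div, norm_mul, gaussNum_scale, norm_mul, norm_pow]
  gcongr
  exact mul_le_of_le_one_left (norm_nonneg _) (pow_le_one₀ (norm_nonneg _) hc)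

theorem summable_gaussTerm {a b u v q : ℂ} (hq : ‖q‖ < 1) (hab : ‖a * b‖ < 1)
    (huv : ‖u * v‖ < 1) : Summable (gaussTerm a b u v q) :=
  (summable_gaussBound hq hab).of_norm_bounded fun n => by
    simpa using norm_gaussTerm_le (c := 1) hq huv (by simp) n

/-- The certificate (1 - q^n) t_n for the shift (a, u) ↦ (aq, uq): it vanishes at n = 0 and tends to
0 at infinity, so summing over n leaves a relation between the two q-Gauss sums. -/
theorem gaussTerm_telescope {a b u v q : ℂ} (hq : ‖q‖ < 1) (huv : ‖u * v‖ < 1) (n : ℕ) :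
    (1 - u * v) * (1 - a * b) * gaussTerm a b u v q n -
        (1 - a * v) * (1 - b * u) * gaussTerm (a * q) b (u * q) v q n =
      (1 - u * v) * ((1 - q ^ n) * gaussTerm a b u v q n -
        (1 - q ^ (n + 1)) * gaussTerm a b u v q (n + 1)) := by
  have h1 := qPoch_self_ne_zero hq (n + 1)
  have h2 := qPoch_ne_zero (mul_pow_ne_one huv hq) (n + 1)
  have h3 : (1 - u * v) * qPoch (u * q * v) q n = qPoch (u * v) q n * (1 - u * v * q ^ n) := by
    rw [← qPoch_succ, add_comm, qPoch_add, mul_right_comm u q v]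
    simp [qPoch]
  have h0 : 1 - u * v ≠ 0 := by simpa using sub_ne_zero.2 (mul_pow_ne_one huv hq 0).symm
  have h4 : qPoch (u * q * v) q n = qPoch (u * v) q n * (1 - u * v * q ^ n) / (1 - u * v) := by
    rw [← h3]
    field_simp
  simp only [gaussTerm, gaussNum_scale, gaussNum_succ, h4]
  rw [qPoch_succ] at h1 h2 ⊢
  rw [qPoch_succ]
  have h5 := left_ne_zero_of_mul h1
  have h6 := right_ne_zero_of_mul h1
  have h7 := left_ne_zero_of_mul h2
  have h8 := right_ne_zero_of_mul h2
  rw [pow_succ']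
  generalize q ^ n = x at *
  clear h1 h2 h3 h4
  generalize 1 - q * x = y at *
  field_simp
  ring

open Filter Topology in
theorem tsum_gaussTerm_step {a b u v q : ℂ} (hq : ‖q‖ < 1) (hab : ‖a * b‖ < 1)
    (huv : ‖u * v‖ < 1) :
    (1 - u * v) * (1 - a * b) * ∑' n, gaussTerm a b u v q n =
      (1 - a * v) * (1 - b * u) * ∑' n, gaussTerm (a * q) b (u * q) v q n := by
  have hs := summable_gaussTerm hq hab huv
  have hs' : Summable (gaussTerm (a * q) b (u * q) v q) :=
    (summable_gaussBound hq hab).of_norm_bounded (norm_gaussTerm_le hq huv hq.le)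
  rw [← sub_eq_zero, ← tsum_mul_left, ← tsum_mul_left,
    ← (hs.mul_left _).tsum_sub (hs'.mul_left _)]
  have hsum := ((hs.mul_left ((1 - u * v) * (1 - a * b))).sub
    (hs'.mul_left ((1 - a * v) * (1 - b * u)))).hasSum.tendsto_sum_nat
  refine tendsto_nhds_unique hsum ?_
  have key (N : ℕ) : ∑ n ∈ Finset.range N, ((1 - u * v) * (1 - a * b) * gaussTerm a b u v q n -
        (1 - a * v) * (1 - b * u) * gaussTerm (a * q) b (u * q) v q n) =
      -((1 - u * v) * ((1 - q ^ N) * gaussTerm a b u v q N)) := by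
    simp only [gaussTerm_telescope hq huv, ← Finset.mul_sum]
    rw [Finset.sum_range_sub' (fun n => (1 - q ^ n) * gaussTerm a b u v q n)]
    simp
  simp only [key]
  have h1 := (tendsto_pow_atTop_nhds_zero_of_norm_lt_one hq).const_sub 1
  simpa using ((h1.mul hs.tendsto_atTop_zero).const_mul (1 - u * v)).neg

open Filter Topology in
theorem tendsto_tsum_gaussTerm {a b u v q : ℂ} (hq : ‖q‖ < 1) (hab : ‖a * b‖ < 1)
    (huv : ‖u * v‖ < 1) :
    Tendsto (fun N : ℕ => ∑' n, gaussTerm (a * q ^ N) b (u * q ^ N) v q n) atTop (𝓝 1) := by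
  have h1 : ∑' n : ℕ, (if n = 0 then (1 : ℂ) else 0) = 1 := tsum_ite_eq 0 (fun _ => (1 : ℂ))
  rw [← h1]
  refine tendsto_tsum_of_dominated_convergence (summable_gaussBound hq hab) (fun n => ?_)
    (Eventually.of_forall fun N => norm_gaussTerm_le hq huv ?_)
  -- Only the term n = 0 survives: by `gaussNum_scale` the n-th numerator carries the factor q^{Nn}.
  · rcases eq_or_ne n 0 with rfl | hn
    · simp [gaussTerm, gaussNum, qPoch]
    · have hN := tendsto_pow_atTop_nhds_zero_of_norm_lt_one hq
      have h2 : Tendsto (fun N : ℕ => qPoch (u * q ^ N * v) q n) atTop (𝓝 1) := by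
        have : Tendsto (fun N : ℕ => qPoch (u * q ^ N * v) q n) atTop
            (𝓝 (∏ k ∈ Finset.range n, (1 - u * 0 * v * q ^ k))) :=
          tendsto_finsetProd _ fun k _ =>
            (((hN.const_mul u).mul_const v).mul_const (q ^ k)).const_sub 1
        simpa using this
      have h3 := ((hN.pow n).mul_const (gaussNum a b u v q n)).div
        (h2.const_mul (qPoch q q n)) (by simpa using qPoch_self_ne_zero hq n)
      simpa [gaussTerm, gaussNum_scale, hn, Pi.div_def] using h3
  · rw [norm_pow]
    exact pow_le_one₀ (norm_nonneg _) hq.le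

open Filter Topology in
/-- The `q`-Gauss summation. -/
theorem tsum_gaussTerm {a b u v q : ℂ} (hq : ‖q‖ < 1) (hab : ‖a * b‖ < 1) (huv : ‖u * v‖ < 1) :
    ∑' n, gaussTerm a b u v q n =
      qPochInf (a * v) q * qPochInf (b * u) q / (qPochInf (u * v) q * qPochInf (a * b) q) := by
  have hstep (N : ℕ) : qPoch (u * v) q N * qPoch (a * b) q N * ∑' n, gaussTerm a b u v q n =
      qPoch (a * v) q N * qPoch (b * u) q N *
        ∑' n, gaussTerm (a * q ^ N) b (u * q ^ N) v q n := by
    induction N with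
    | zero => simp [qPoch]
    | succ N ih =>
      have hN : ‖q ^ N‖ ≤ 1 := by
        rw [norm_pow]
        exact pow_le_one₀ (norm_nonneg _) hq.le
      have hsmall {x y : ℂ} (h : ‖x * y‖ < 1) : ‖x * q ^ N * y‖ < 1 := by
        rw [mul_right_comm, norm_mul]
        exact mul_lt_one_of_nonneg_of_lt_one_left (norm_nonneg _) h hN
      have h := tsum_gaussTerm_step hq (hsmall hab) (hsmall huv)
      simp only [qPoch_succ, pow_succ, ← mul_assoc]
      linear_combination (1 - u * v * q ^ N) * (1 - a * b * q ^ N) * ih +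
        qPoch (a * v) q N * qPoch (b * u) q N * h
  have hL := (((tendsto_qPoch (u * v) hq).mul (tendsto_qPoch (a * b) hq)).mul_const
    (∑' n, gaussTerm a b u v q n))
  have hR := (((tendsto_qPoch (a * v) hq).mul (tendsto_qPoch (b * u) hq)).mul
    (tendsto_tsum_gaussTerm (a := a) (b := b) hq hab huv))
  simp only [hstep] at hL
  have h := tendsto_nhds_unique hL hR
  rw [mul_one] at h
  rw [eq_div_iff (mul_ne_zero (qPochInf_ne_zero hq (mul_pow_ne_one huv hq))
    (qPochInf_ne_zero hq (mul_pow_ne_one hab hq))), mul_comm, h]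

/-! ### Bailey's lemma: bounds and the double series -/

theorem qPochMulPow_add (a q : ℂ) (r m : ℕ) :
    qPochMulPow a q (r + m) =
      qPochMulPow a q r * ∏ k ∈ Finset.range m, (a - q ^ (r + 1) * q ^ k) := by
  simp only [qPochMulPow, Finset.prod_range_add, ← pow_add, add_right_comm]

/-- Successive ratios tend to |ab|, so any ρ above it will do; taking ρ < |q| leaves room to absorb
the growth |q|^{-r} of `baileyAlpha`. -/
theorem exists_norm_qPochMulPow_le {a b q : ℂ} (hq : ‖q‖ < 1) (hab : ‖a * b‖ < ‖q‖) :
    ∃ K ρ : ℝ, 0 ≤ K ∧ 0 < ρ ∧ ρ < ‖q‖ ∧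
      ∀ n, ‖qPochMulPow a q n * qPochMulPow b q n‖ ≤ K * ρ ^ n := by
  obtain ⟨ρ, h1, h2⟩ := exists_between hab
  have hρ : 0 < ρ := (norm_nonneg _).trans_lt h1
  have hs : Summable fun n => ‖qPochMulPow a q n * qPochMulPow b q n‖ / ρ ^ n := by
    refine summable_of_succ_eq_mul_of_tendsto (l := ‖a * b‖ / ρ)
      (g := fun n => ‖(a - q * q ^ n) * (b - q * q ^ n)‖ / ρ) ?_ ?_ ?_
    · intro n
      simp only [qPochMulPow_succ, norm_mul, ← pow_succ']
      rw [div_mul_div_comm, ← pow_succ]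
      congr 1
      ring
    · have h := (((tendsto_mul_pow_zero q hq).const_sub a).mul
        ((tendsto_mul_pow_zero q hq).const_sub b)).norm.div_const ρ
      simpa using h
    · rw [Real.norm_of_nonneg (by positivity), div_lt_one hρ]
      exact h1
  obtain ⟨K, hK⟩ := hs.tendsto_atTop_zero.bddAbove_range
  have hK' (n : ℕ) : ‖qPochMulPow a q n * qPochMulPow b q n‖ / ρ ^ n ≤ K :=
    hK (Set.mem_range_self n)
  refine ⟨K, ρ, le_trans (by positivity) (hK' 0), hρ, h2, fun n => ?_⟩
  exact (div_le_iff₀ (pow_pos hρ n)).1 (hK' n)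

theorem exists_norm_qPochRecip_le {q : ℂ} (hq : ‖q‖ < 1) :
    ∃ C : ℝ, 0 ≤ C ∧ ∀ n : ℕ, ‖qPochRecip q n‖ ≤ C := by
  obtain ⟨C, hC⟩ :=
    ((tendsto_qPoch q hq).inv₀ (qPochInf_ne_zero hq (mul_pow_ne_one hq hq))).norm.bddAbove_range
  have h (n : ℕ) : ‖qPochRecip q n‖ ≤ C := by
    rw [qPochRecip_natCast]
    exact hC (Set.mem_range_self n)
  exact ⟨C, (norm_nonneg _).trans (h 0), h⟩

theorem norm_sum_thetaCoeff_le {q : ℂ} (hq : ‖q‖ < 1) (r : ℕ) :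
    ‖∑ j ∈ Finset.range (r + 1), thetaCoeff q j‖ ≤ ((r : ℝ) + 1) * 2 := by
  have h (j : ℕ) : ‖thetaCoeff q j‖ ≤ 2 := by
    unfold thetaCoeff
    split_ifs
    · simp
    · simpa using pow_le_one₀ (norm_nonneg _) hq.le
  simpa using norm_sum_le_of_le (Finset.range (r + 1)) fun j _ => h j

/-- The sequence `α` of the Bailey pair of `sum_bailey_pair`. -/
noncomputable def baileyAlpha (q : ℂ) (r : ℕ) : ℂ :=
  (1 - q ^ (2 * r + 1)) / q ^ r * ∑ j ∈ Finset.range (r + 1), thetaCoeff q j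

theorem norm_baileyAlpha_le {q : ℂ} (hq : ‖q‖ < 1) (r : ℕ) :
    ‖baileyAlpha q r‖ ≤ 4 * ((r : ℝ) + 1) / ‖q‖ ^ r := by
  have h1 : ‖1 - q ^ (2 * r + 1)‖ ≤ 2 := by
    refine (norm_sub_le _ _).trans ?_
    rw [norm_one, norm_pow]
    linarith [pow_le_one₀ (n := 2 * r + 1) (norm_nonneg q) hq.le]
  rw [baileyAlpha, norm_mul, norm_div, norm_pow]
  calc ‖1 - q ^ (2 * r + 1)‖ / ‖q‖ ^ r * ‖∑ j ∈ Finset.range (r + 1), thetaCoeff q j‖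
      ≤ 2 / ‖q‖ ^ r * (((r : ℝ) + 1) * 2) := by
        gcongr
        exact norm_sum_thetaCoeff_le hq r
    _ = 4 * ((r : ℝ) + 1) / ‖q‖ ^ r := by ring

/-- The double series which is summed in two ways in Bailey's lemma. -/
noncomputable def baileyTerm (a b q : ℂ) (p : ℕ × ℕ) : ℂ :=
  baileyAlpha q p.1 * (qPochMulPow a q (p.1 + p.2) * qPochMulPow b q (p.1 + p.2)) *
    (qPochRecip q p.2 * qPochRecip q (2 * p.1 + p.2 + 1 : ℕ))

theorem summable_baileyTerm {a b q : ℂ} (hq : ‖q‖ < 1) (hab : ‖a * b‖ < ‖q‖) :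
    Summable (baileyTerm a b q) := by
  obtain ⟨K, ρ, hK, hρ, hρq, hP⟩ := exists_norm_qPochMulPow_le hq hab
  obtain ⟨C, hC, hR⟩ := exists_norm_qPochRecip_le hq
  have hq0 : 0 < ‖q‖ := hρ.trans hρq
  have hx : ‖ρ / ‖q‖‖ < 1 := by
    rw [Real.norm_of_nonneg (by positivity), div_lt_one hq0]
    exact hρq
  have s1 : Summable fun r : ℕ => 4 * ((r : ℝ) + 1) * (ρ / ‖q‖) ^ r := by
    have h1 := summable_pow_mul_geometric_of_norm_lt_one 1 hx
    have h2 := summable_geometric_of_norm_lt_one hx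
    refine ((h1.add h2).mul_left 4).congr fun r => ?_
    ring
  have s2 : Summable fun m : ℕ => K * C ^ 2 * ρ ^ m :=
    (summable_geometric_of_lt_one hρ.le (hρq.trans hq)).mul_left _
  refine (s1.mul_of_nonneg s2 (fun r => by positivity) (fun m => by positivity)).of_norm_bounded ?_
  rintro ⟨r, m⟩
  rw [baileyTerm, norm_mul, norm_mul, norm_mul (qPochRecip _ _)]
  -- Since ρ^{r+m} = ρ^r ρ^m, the majorant is a product of a summable function of r and one of m.
  calc _ ≤ (4 * ((r : ℝ) + 1) / ‖q‖ ^ r) * (K * ρ ^ (r + m)) * (C * C) := by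
        gcongr
        · exact norm_baileyAlpha_le hq r
        · exact hP _
        · exact hR _
        · exact hR _
    _ = _ := by
        rw [div_pow, pow_add]
        ring

/-- Splitting off the first r factors of each numerator, and the first 2r + 1 of (q;q)_{2r+m+1},
leaves a q-Gauss series with u = v = q^{r+1}. -/
theorem tsum_baileyTerm_snd {a b q : ℂ} (hq : ‖q‖ < 1) (hab : ‖a * b‖ < 1)
    (ha : ∀ k : ℕ, q * a * q ^ k ≠ 1) (hb : ∀ k : ℕ, q * b * q ^ k ≠ 1) (r : ℕ) :
    ∑' m, baileyTerm a b q (r, m) =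
      qPochInf (q * a) q * qPochInf (q * b) q / (qPochInf q q * qPochInf (a * b) q) *
        (baileyAlpha q r * (qPochMulPow a q r * qPochMulPow b q r) /
          (qPoch (q * a) q r * qPoch (q * b) q r)) := by
  have huv : ‖q ^ (r + 1) * q ^ (r + 1)‖ < 1 := by
    rw [← pow_add, norm_pow]
    exact pow_lt_one₀ (norm_nonneg _) hq (by lia)
  have hterm (m : ℕ) : baileyTerm a b q (r, m) =
      baileyAlpha q r * (qPochMulPow a q r * qPochMulPow b q r) / qPoch q q (2 * r + 1) *
        gaussTerm a b (q ^ (r + 1)) (q ^ (r + 1)) q m := by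
    have e : q * q ^ (2 * r + 1) = q ^ (r + 1) * q ^ (r + 1) := by ring
    rw [baileyTerm, gaussTerm, gaussNum, Finset.prod_mul_distrib, qPochMulPow_add, qPochMulPow_add,
      qPochRecip_natCast, qPochRecip_natCast, add_right_comm (2 * r) m 1, qPoch_add, e]
    simp only [div_eq_mul_inv, mul_inv]
    ring
  simp only [hterm]
  rw [tsum_mul_left, tsum_gaussTerm hq hab huv, qPochInf_eq_mul q hq (2 * r + 1),
    qPochInf_eq_mul (q * a) hq r, qPochInf_eq_mul (q * b) hq r]
  have h1 := qPoch_ne_zero ha r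
  have h2 := qPoch_ne_zero hb r
  rw [show q * a * q ^ r = a * q ^ (r + 1) by ring, show q * b * q ^ r = b * q ^ (r + 1) by ring,
    show q * q ^ (2 * r + 1) = q ^ (r + 1) * q ^ (r + 1) by ring]
  generalize qPoch (q * a) q r = x at *
  generalize qPoch (q * b) q r = y at *
  field_simp

/-- With m = n - r the indices m and 2r + m + 1 become n - r and n + r + 1, those of the Bailey
pair. -/
theorem sum_baileyTerm_antidiagonal {a b q : ℂ} (hq : ‖q‖ < 1) (hq0 : q ≠ 0) (n : ℕ) :
    ∑ p ∈ Finset.HasAntidiagonal.antidiagonal n, baileyTerm a b q p =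
      qPochMulPow a q n * qPochMulPow b q n / q ^ n / qPoch (q ^ 2) (q ^ 2) n := by
  have h := sum_bailey_pair hq hq0 n
  rw [Finset.Nat.sum_antidiagonal_eq_sum_range_succ_mk]
  calc _ = ∑ r ∈ Finset.range (n + 1), qPochMulPow a q n * qPochMulPow b q n *
        ((1 - q ^ (2 * r + 1)) / q ^ r * (∑ j ∈ Finset.range (r + 1), thetaCoeff q j) *
        (qPochRecip q ((n : ℤ) - r) * qPochRecip q ((n : ℤ) + r + 1))) := by
        refine Finset.sum_congr rfl fun r hr => ?_
        have hr' : r ≤ n := Nat.lt_succ_iff.1 (Finset.mem_range.1 hr)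
        have e : ((2 * r + (n - r) + 1 : ℕ) : ℤ) = (n : ℤ) + r + 1 := by lia
        simp only [baileyTerm, baileyAlpha, Nat.add_sub_cancel' hr', e, Nat.cast_sub hr']
        ring
    _ = _ := by
        rw [← Finset.mul_sum, h]
        ring

theorem hasSum_bailey {a b q : ℂ} (hq : ‖q‖ < 1) (hq0 : q ≠ 0) (hab : ‖a * b‖ < ‖q‖)
    (ha : ∀ k : ℕ, q * a * q ^ k ≠ 1) (hb : ∀ k : ℕ, q * b * q ^ k ≠ 1) :
    Summable (fun n : ℕ =>
      qPochMulPow a q n * qPochMulPow b q n / q ^ n / qPoch (q ^ 2) (q ^ 2) n) ∧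
    HasSum (fun r : ℕ => baileyAlpha q r * (qPochMulPow a q r * qPochMulPow b q r) /
        (qPoch (q * a) q r * qPoch (q * b) q r))
      (qPochInf q q * qPochInf (a * b) q / (qPochInf (q * a) q * qPochInf (q * b) q) *
        ∑' n : ℕ, qPochMulPow a q n * qPochMulPow b q n / q ^ n / qPoch (q ^ 2) (q ^ 2) n) := by
  have hab1 := hab.trans hq
  have hs := summable_baileyTerm hq hab
  have hdiag : HasSum (fun n : ℕ =>
      qPochMulPow a q n * qPochMulPow b q n / q ^ n / qPoch (q ^ 2) (q ^ 2) n)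
      (∑' p, baileyTerm a b q p) := by
    have h := (Finset.HasAntidiagonal.sigmaAntidiagonalEquivProd (A := ℕ)).hasSum_iff.2 hs.hasSum
    refine h.sigma fun n => ?_
    rw [← sum_baileyTerm_antidiagonal hq hq0 n, ← Finset.sum_coe_sort]
    exact hasSum_fintype fun p : Finset.HasAntidiagonal.antidiagonal n => baileyTerm a b q p
  refine ⟨hdiag.summable, ?_⟩
  rw [hdiag.tsum_eq]
  have hrow := hs.hasSum.prod_fiberwise fun r => (hs.prod_factor r).hasSum
  simp only [tsum_baileyTerm_snd hq hab1 ha hb] at hrow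
  have h1 := qPochInf_ne_zero hq ha
  have h2 := qPochInf_ne_zero hq hb
  have h3 := qPochInf_ne_zero hq (mul_pow_ne_one hq hq)
  have h4 := qPochInf_ne_zero hq (mul_pow_ne_one hab1 hq)
  refine (hrow.mul_left (qPochInf q q * qPochInf (a * b) q /
    (qPochInf (q * a) q * qPochInf (q * b) q))).congr_fun fun r => ?_
  field_simp

/-! ### Specialisations and the final statement -/

theorem sum_Icc_mul_theta (q c d e : ℂ) (n : ℕ) :
    ∑ j ∈ Finset.Icc (-(n : ℤ)) n, (-1 : ℂ) ^ j * c * q ^ (j ^ 2) * d / e =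
      c * (∑ j ∈ Finset.range (n + 1), thetaCoeff q j) * d / e := by
  rw [← sum_Icc_theta, Finset.mul_sum, Finset.sum_mul, Finset.sum_div]
  refine Finset.sum_congr rfl fun j _ => ?_
  ring

theorem qPoch_zero_left (q : ℂ) (n : ℕ) : qPoch 0 q n = 1 := by simp [qPoch]

theorem qPochInf_zero_left (q : ℂ) : qPochInf 0 q = 1 := by simp [qPochInf]

theorem qPochMulPow_one (q : ℂ) (n : ℕ) : qPochMulPow 1 q n = qPoch q q n := by
  simp [qPochMulPow, qPoch, pow_succ']

theorem qPochMulPow_neg_one (q : ℂ) (n : ℕ) :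
    qPochMulPow (-1) q n = (-1) ^ n * qPoch (-q) q n := by
  induction n with
  | zero => simp [qPochMulPow, qPoch]
  | succ n ih => rw [qPochMulPow_succ, qPoch_succ, ih]; ring

theorem qPochMulPow_zero_left {q : ℂ} (hq : q ≠ 0) (n : ℕ) :
    qPochMulPow 0 q n / q ^ n = (-1) ^ n * q ^ (n * (n - 1) / 2) := by
  induction n with
  | zero => simp [qPochMulPow]
  | succ n ih =>
    -- Writing n(n-1)/2 as ∑_{i<n} i removes the truncated subtraction and division before the
    -- induction step.
    rw [← Finset.sum_range_id_mul_two, Nat.mul_div_cancel _ two_pos] at ih ⊢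
    rw [qPochMulPow_succ, Finset.sum_range_succ, pow_add, pow_succ (-1 : ℂ)]
    rw [div_eq_iff (pow_ne_zero n hq)] at ih
    rw [div_eq_iff (mul_ne_zero (pow_ne_zero n hq) (pow_ne_zero 1 hq)), ih]
    ring

theorem zpow_triangle (q : ℂ) (n : ℕ) :
    q ^ ((n : ℤ) * (n - 1) / 2) = q ^ (n * (n - 1) / 2) := by
  rw [← zpow_natCast]
  congr 1
  -- At n = 0 the factor n - 1 is 0 in ℕ but -1 in ℤ; both products are 0.
  rcases n with _ | n
  · simp
  · push_cast
    simp

theorem neg_one_pow_mul_self (n : ℕ) : (-1 : ℂ) ^ n * (-1) ^ n = 1 := by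
  rw [← mul_pow]
  simp

theorem hasSum_generalized {q a b : ℂ} (hq : ‖q‖ < 1) (hq0 : q ≠ 0) (hab : ‖a * b / q‖ < 1)
    (ha : ∀ k : ℕ, a * q ^ (k + 1) ≠ 1) (hb : ∀ k : ℕ, b * q ^ (k + 1) ≠ 1) :
    Summable (fun n : ℕ =>
        qPochMulPow a q n * qPochMulPow b q n / q ^ n / qPoch (q ^ 2) (q ^ 2) n) ∧
      HasSum (fun n : ℕ => ∑ j ∈ Finset.Icc (-(n : ℤ)) n,
          (-1 : ℂ) ^ j * (1 - q ^ (2 * n + 1)) * q ^ (j ^ 2) *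
            (qPochMulPow a q n * qPochMulPow b q n / q ^ n) /
            (qPoch (q * a) q n * qPoch (q * b) q n))
        (qPochInf q q * qPochInf (a * b) q / (qPochInf (q * a) q * qPochInf (q * b) q) *
          ∑' n : ℕ, qPochMulPow a q n * qPochMulPow b q n / q ^ n /
            qPoch (q ^ 2) (q ^ 2) n) := by
  have hab' : ‖a * b‖ < ‖q‖ := by
    rwa [norm_div, div_lt_one (norm_pos_iff.2 hq0)] at hab
  have h := hasSum_bailey hq hq0 hab' (fun k => by convert ha k using 1; ring)
    (fun k => by convert hb k using 1; ring)
  refine ⟨h.1, h.2.congr_fun fun n => ?_⟩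
  rw [sum_Icc_mul_theta, baileyAlpha]
  ring

theorem mainTheorem12 (q : ℝ) (hq0 : 0 < q) (hq1 : q < 1) :
    -- the identity for nonzero `a`, `b`
    (∀ a b : ℂ, a ≠ 0 → b ≠ 0 → ‖a * b / (q : ℂ)‖ < 1 →
      (∀ k : ℕ, a * (q : ℂ) ^ (k + 1) ≠ 1) → (∀ k : ℕ, b * (q : ℂ) ^ (k + 1) ≠ 1) →
      Summable (fun n : ℕ =>
        qPoch (q / a) q n * qPoch (q / b) q n * (a * b / q) ^ n / qPoch (q ^ 2) (q ^ 2) n) ∧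
      HasSum (fun n : ℕ => ∑ j ∈ Finset.Icc (-(n : ℤ)) n,
          (-1 : ℂ) ^ j * (1 - (q : ℂ) ^ (2 * n + 1)) * (q : ℂ) ^ (j ^ 2) *
            (qPoch (q / a) q n * qPoch (q / b) q n * (a * b / q) ^ n) /
            (qPoch (q * a) q n * qPoch (q * b) q n))
        (qPochInf q q * qPochInf (a * b) q / (qPochInf (q * a) q * qPochInf (q * b) q) *
          ∑' n : ℕ, qPoch (q / a) q n * qPoch (q / b) q n * (a * b / q) ^ n /
            qPoch (q ^ 2) (q ^ 2) n)) ∧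
    -- the same identity with `a = 0` or `b = 0` allowed
    (∀ a b : ℂ, ‖a * b / (q : ℂ)‖ < 1 →
      (∀ k : ℕ, a * (q : ℂ) ^ (k + 1) ≠ 1) → (∀ k : ℕ, b * (q : ℂ) ^ (k + 1) ≠ 1) →
      Summable (fun n : ℕ =>
        qPochMulPow a q n * qPochMulPow b q n / (q : ℂ) ^ n / qPoch (q ^ 2) (q ^ 2) n) ∧
      HasSum (fun n : ℕ => ∑ j ∈ Finset.Icc (-(n : ℤ)) n,
          (-1 : ℂ) ^ j * (1 - (q : ℂ) ^ (2 * n + 1)) * (q : ℂ) ^ (j ^ 2) *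
            (qPochMulPow a q n * qPochMulPow b q n / (q : ℂ) ^ n) /
            (qPoch (q * a) q n * qPoch (q * b) q n))
        (qPochInf q q * qPochInf (a * b) q / (qPochInf (q * a) q * qPochInf (q * b) q) *
          ∑' n : ℕ, qPochMulPow a q n * qPochMulPow b q n / (q : ℂ) ^ n /
            qPoch (q ^ 2) (q ^ 2) n)) ∧
    -- `(a, b) = (0, 0)`
    (Summable (fun n : ℕ => (q : ℂ) ^ (n ^ 2) / qPoch (q ^ 2) (q ^ 2) n) ∧
      Summable (fun n : ℕ => ∑ j ∈ Finset.Icc (-(n : ℤ)) n,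
        (-1 : ℂ) ^ j * (1 - (q : ℂ) ^ (2 * n + 1)) * (q : ℂ) ^ ((n : ℤ) ^ 2 + j ^ 2)) ∧
      ∑' n : ℕ, (q : ℂ) ^ (n ^ 2) / qPoch (q ^ 2) (q ^ 2) n =
        1 / qPochInf q q * ∑' n : ℕ, ∑ j ∈ Finset.Icc (-(n : ℤ)) n,
          (-1 : ℂ) ^ j * (1 - (q : ℂ) ^ (2 * n + 1)) * (q : ℂ) ^ ((n : ℤ) ^ 2 + j ^ 2)) ∧
    -- `(a, b) = (1, 0)`
    (Summable (fun n : ℕ => (-1 : ℂ) ^ n * (q : ℂ) ^ (n * (n - 1) / 2) / qPoch (-q) q n) ∧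
      Summable (fun n : ℕ => ∑ j ∈ Finset.Icc (-(n : ℤ)) n,
        (-1 : ℂ) ^ ((n : ℤ) + j) * (1 - (q : ℂ) ^ (2 * n + 1)) *
          (q : ℂ) ^ (j ^ 2 + (n : ℤ) * (n - 1) / 2)) ∧
      ∑' n : ℕ, (-1 : ℂ) ^ n * (q : ℂ) ^ (n * (n - 1) / 2) / qPoch (-q) q n =
        ∑' n : ℕ, ∑ j ∈ Finset.Icc (-(n : ℤ)) n,
          (-1 : ℂ) ^ ((n : ℤ) + j) * (1 - (q : ℂ) ^ (2 * n + 1)) *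
            (q : ℂ) ^ (j ^ 2 + (n : ℤ) * (n - 1) / 2)) ∧
    -- `(a, b) = (-1, 0)`
    (Summable (fun n : ℕ => (q : ℂ) ^ (n * (n - 1) / 2) / qPoch q q n) ∧
      Summable (fun n : ℕ => ∑ j ∈ Finset.Icc (-(n : ℤ)) n,
        (-1 : ℂ) ^ j * (1 - (q : ℂ) ^ (2 * n + 1)) *
          (q : ℂ) ^ (j ^ 2 + (n : ℤ) * (n - 1) / 2)) ∧
      ∑' n : ℕ, (q : ℂ) ^ (n * (n - 1) / 2) / qPoch q q n =
        qPochInf (-q) q / qPochInf q q * ∑' n : ℕ, ∑ j ∈ Finset.Icc (-(n : ℤ)) n,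
          (-1 : ℂ) ^ j * (1 - (q : ℂ) ^ (2 * n + 1)) *
            (q : ℂ) ^ (j ^ 2 + (n : ℤ) * (n - 1) / 2)) := by
  
  have hq : ‖(q : ℂ)‖ < 1 := by
    rwa [Complex.norm_real, Real.norm_of_nonneg hq0.le]
  have hqc : (q : ℂ) ≠ 0 := by exact_mod_cast hq0.ne'
  have hne (k : ℕ) : (q : ℂ) * q ^ k ≠ 1 := mul_pow_ne_one hq hq k
  have hneg (k : ℕ) : -(q : ℂ) * q ^ k ≠ 1 := mul_pow_ne_one (by rwa [norm_neg]) hq k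
  have hinf : qPochInf (q : ℂ) q ≠ 0 := qPochInf_ne_zero hq hne
  have hinf' : qPochInf (-(q : ℂ)) q ≠ 0 := qPochInf_ne_zero hq hneg
  have hz (m n : ℤ) : (q : ℂ) ^ (m + n) = q ^ m * q ^ n := zpow_add₀ hqc m n
  refine ⟨fun a b ha0 hb0 hab ha hb => ?_, fun a b hab ha hb => hasSum_generalized hq hqc hab ha hb,
    ?_, ?_, ?_⟩
  · have h := hasSum_generalized hq hqc hab ha hb
    have e (n : ℕ) : qPochMulPow a q n * qPochMulPow b q n / (q : ℂ) ^ n =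
        qPoch (q / a) q n * qPoch (q / b) q n * (a * b / q) ^ n := by
      rw [qPochMulPow_eq a q ha0, qPochMulPow_eq b q hb0, div_pow, mul_pow]
      ring
    simpa only [e] using h
  · obtain ⟨h1, h2⟩ := hasSum_generalized (a := 0) (b := 0) hq hqc (by simp) (by simp) (by simp)
    have hsq (n : ℕ) : qPochMulPow 0 q n * qPochMulPow 0 q n / (q : ℂ) ^ n = q ^ (n ^ 2) := by
      have hT : n * (n - 1) / 2 * 2 + n = n ^ 2 := by
        rw [← Finset.sum_range_id_mul_two, Nat.mul_div_cancel _ two_pos,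
          Finset.sum_range_id_mul_two]
        cases n
        · rfl
        · simp only [Nat.add_sub_cancel]
          ring
      have h := qPochMulPow_zero_left hqc n
      rw [mul_div_assoc, h, (div_eq_iff (pow_ne_zero n hqc)).1 h, ← hT, pow_add, pow_mul]
      linear_combination ((q : ℂ) ^ (n * (n - 1) / 2)) ^ 2 * q ^ n * neg_one_pow_mul_self n
    -- The denominator `1 * 1` is the form taken by the two factors (0;q)_n in `h2` after
    -- simplification.
    have hF (n : ℕ) (j : ℤ) : (-1 : ℂ) ^ j * (1 - (q : ℂ) ^ (2 * n + 1)) *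
          (q : ℂ) ^ ((n : ℤ) ^ 2 + j ^ 2) =
        (-1 : ℂ) ^ j * (1 - (q : ℂ) ^ (2 * n + 1)) * (q : ℂ) ^ (j ^ 2) *
          q ^ (n ^ 2) / (1 * 1) := by
      rw [hz, show (n : ℤ) ^ 2 = (n ^ 2 : ℕ) by push_cast; rfl, zpow_natCast]
      ring
    simp only [hsq, mul_zero, qPoch_zero_left, qPochInf_zero_left, ← hF] at h1 h2
    refine ⟨h1, h2.summable, ?_⟩
    rw [h2.tsum_eq]
    field_simp
  · obtain ⟨h1, h2⟩ := hasSum_generalized (a := 1) (b := 0) hq hqc (by simp)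
      (fun k => by simpa [pow_succ'] using hne k) (by simp)
    have hL (n : ℕ) : qPochMulPow 1 q n * qPochMulPow 0 q n / (q : ℂ) ^ n /
        qPoch (q ^ 2) (q ^ 2) n = (-1) ^ n * q ^ (n * (n - 1) / 2) / qPoch (-q) q n := by
      have h3 := qPoch_ne_zero hne n
      rw [mul_div_assoc, qPochMulPow_zero_left hqc, qPochMulPow_one, qPoch_sq]
      field_simp
    have hF (n : ℕ) (j : ℤ) : (-1 : ℂ) ^ j * (1 - (q : ℂ) ^ (2 * n + 1)) * (q : ℂ) ^ (j ^ 2) *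
          (qPochMulPow 1 q n * qPochMulPow 0 q n / (q : ℂ) ^ n) / (qPoch q q n * 1) =
        (-1 : ℂ) ^ ((n : ℤ) + j) * (1 - (q : ℂ) ^ (2 * n + 1)) *
          (q : ℂ) ^ (j ^ 2 + (n : ℤ) * (n - 1) / 2) := by
      have h3 := qPoch_ne_zero hne n
      rw [mul_div_assoc (qPochMulPow 1 _ _), qPochMulPow_zero_left hqc, qPochMulPow_one, hz,
        zpow_triangle, zpow_add₀ (by simp), zpow_natCast]
      field_simp
    simp only [hL, mul_zero, mul_one, qPoch_zero_left, qPochInf_zero_left] at h1 h2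
    simp only [mul_one] at hF
    -- At a = 1 the prefactor is (q;q)_∞ / (q;q)_∞ = 1, so none appears in the identity.
    simp only [hF, div_self hinf, one_mul] at h2
    exact ⟨h1, h2.summable, h2.tsum_eq.symm⟩
  · obtain ⟨h1, h2⟩ := hasSum_generalized (a := -1) (b := 0) hq hqc (by simp)
      (fun k => by simpa [pow_succ'] using hneg k) (by simp)
    have hP (n : ℕ) : qPochMulPow (-1) q n * qPochMulPow 0 q n / (q : ℂ) ^ n =
        qPoch (-q) q n * q ^ (n * (n - 1) / 2) := by
      rw [mul_div_assoc, qPochMulPow_zero_left hqc, qPochMulPow_neg_one]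
      linear_combination qPoch (-q) q n * (q : ℂ) ^ (n * (n - 1) / 2) * neg_one_pow_mul_self n
    have hL (n : ℕ) : qPoch (-q) q n * (q : ℂ) ^ (n * (n - 1) / 2) / qPoch (q ^ 2) (q ^ 2) n =
        q ^ (n * (n - 1) / 2) / qPoch q q n := by
      have h3 := qPoch_ne_zero hneg n
      rw [qPoch_sq]
      field_simp
    have hF (n : ℕ) (j : ℤ) : (-1 : ℂ) ^ j * (1 - (q : ℂ) ^ (2 * n + 1)) * (q : ℂ) ^ (j ^ 2) *
          (qPoch (-q) q n * q ^ (n * (n - 1) / 2)) / qPoch (-q) q n =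
        (-1 : ℂ) ^ j * (1 - (q : ℂ) ^ (2 * n + 1)) *
          (q : ℂ) ^ (j ^ 2 + (n : ℤ) * (n - 1) / 2) := by
      have h3 := qPoch_ne_zero hneg n
      rw [hz, zpow_triangle]
      field_simp
    simp only [hP, hL, hF, mul_zero, mul_one, mul_neg, qPoch_zero_left, qPochInf_zero_left]
      at h1 h2
    refine ⟨h1, h2.summable, ?_⟩
    rw [h2.tsum_eq]
    field_simp
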